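/- Let $(\mathscr C,\mathbb E,\mathfrak s)$ be an extriangulated category in the sense of Nakaoka and Palu. For a class $\mathcal Y$ of objects of an extriangulated category $\mathscr D$, a $\mathcal Y$-filtration of length $n\ge 0$ of an object $M$ is a sequence of inflations $0=M_0\to M_1\to\cdots\to M_n=M$ in $\mathscr D$ whose cones $Y_1,\dots,Y_n$ lie in $\mathcal Y$; we write $M\sim(Y_1,\dots,Y_n)_{\mathcal Y}$. Let $\mathbf{Filt}_{\mathscr D}(\mathcal Y)$ be the full subcategory of the objects that have a $\mathcal Y$-filtration, and for such an object $M$ let $l_{\mathcal Y}(M)$ be the minimal length of its $\mathcal Y$-filtrations. We say that $\mathscr D$ satisfies the Jordan–Hölder property (JHP) with respect to $\mathcal Y$ if 1. $\mathscr D=\mathbf{Filt}_{\mathscr D}(\mathcal Y)$; 2. whenever $M\sim(Y_1,\dots,Y_n)_{\mathcal Y}$ and $M\sim(Y_1',\dots,Y_n')_{\mathcal Y}$ with $n=l_{\mathcal Y}(M)$, there is a permutation $\sigma$ of $\{1,\dots,n\}$ with $Y_i\cong Y'_{\sigma(i)}$ for all $i$; and 3. for each object $M$ all $\mathcal Y$-filtrations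 of $M$ have the same length. We say that $\mathscr D$ satisfies (JHP) if it satisfies (JHP) with respect to some class $\mathcal Y$ of its objects. Let $\mathcal X$ be a semibrick in $\mathscr C$, that is, a class of objects whose endomorphism rings are division rings, with $\operatorname{Hom}_{\mathscr C}(X_1,X_2)=0$ for any two non-isomorphic $X_1,X_2\in\mathcal X$. Call $\mathcal X$ proper if for no $X\in\mathcal X$ there is an $\mathbb E$-triangle $X\to 0\to N\dashrightarrow$ with $N\in\mathbf{Filt}_{\mathscr C}(\mathcal X)$ (that is, $X[1]\notin\mathbf{Filt}_{\mathscr C}(\mathcal X)$ for all $X\in\mathcal X$). Let $\mathcal T=\mathbf{Filt}_{\mathscr C}(\mathcal X)$, which is extension-closed in $\mathscr C$ and hence an extriangulated category with the restrictions of $\mathbb E$ and $\mathfrak s$. **Theorem.** $\mathcal T$ satisfies (JHP) if and only if $\mathcal X$ is proper. Likewise, $\mathcal T$ satisfies (JHP) with respect to $\mathcal X$ itself if and only if $\mathcal X$ is proper. -/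

import Mathlib

open CategoryTheory CategoryTheory.Limits Opposite
open scoped ZeroObject

universe w v u

section Bifunctor

variable {C : Type u} [Category.{v} C]

/-- The group `𝔼(Z, A)` of `𝔼`-extensions, for a bifunctor `𝔼 : Cᵒᵖ × C → Ab` (in curried form). -/
abbrev ExtGroup (E : Cᵒᵖ ⥤ C ⥤ AddCommGrpCat.{w}) (Z A : C) : Type w :=
  ((E.obj (op Z)).obj A : AddCommGrpCat.{w})

/-- The extension `a_* δ = 𝔼(Z, a)(δ)`. -/
def extPush (E : Cᵒᵖ ⥤ C ⥤ AddCommGrpCat.{w}) {Z A A' : C} (a : A ⟶ A')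
    (δ : ExtGroup E Z A) : ExtGroup E Z A' :=
  ((E.obj (op Z)).map a).hom δ

/-- The extension `c^* δ = 𝔼(c, A)(δ)`. -/
def extPull (E : Cᵒᵖ ⥤ C ⥤ AddCommGrpCat.{w}) {Z Z' A : C} (c : Z' ⟶ Z)
    (δ : ExtGroup E Z A) : ExtGroup E Z' A :=
  ((E.map c.op).app A).hom δ

/-- Two sequences `A ⟶ B ⟶ Z` and `A ⟶ B' ⟶ Z` are equivalent if there is an isomorphism `B ≅ B'`
compatible with the identities of `A` and `Z`. -/
def SeqEquiv {A B B' Z : C} (x : A ⟶ B) (y : B ⟶ Z) (x' : A ⟶ B') (y' : B' ⟶ Z) : Prop :=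
  ∃ b : B ≅ B', x ≫ b.hom = x' ∧ b.hom ≫ y' = y

end Bifunctor

section Biproduct

variable {C : Type u} [Category.{v} C] [Preadditive C]

/-- `b` exhibits its apex as a biproduct (the identities `inl ≫ fst = 𝟙`, `inl ≫ snd = 0`,
`inr ≫ fst = 0`, `inr ≫ snd = 𝟙` are part of the notion of a bicone). -/
def IsDirectSum {X Y : C} (b : BinaryBicone X Y) : Prop :=
  b.fst ≫ b.inl + b.snd ≫ b.inr = 𝟙 b.pt

/-- The morphism `f ⊕ f'` between direct sums. -/
def directSumMap {X Y X' Y' : C} (b : BinaryBicone X X') (c : BinaryBicone Y Y')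
    (f : X ⟶ Y) (f' : X' ⟶ Y') : b.pt ⟶ c.pt :=
  b.fst ≫ f ≫ c.inl + b.snd ≫ f' ≫ c.inr

/-- The extension `δ ⊕ δ'`, i.e. the element of `𝔼(Z ⊕ Z', A ⊕ A')` corresponding to
`(δ, 0, 0, δ')` in `𝔼(Z, A) ⊕ 𝔼(Z, A') ⊕ 𝔼(Z', A) ⊕ 𝔼(Z', A')`. -/
def directSumExt (E : Cᵒᵖ ⥤ C ⥤ AddCommGrpCat.{w}) {A A' Z Z' : C}
    (bA : BinaryBicone A A') (bZ : BinaryBicone Z Z')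
    (δ : ExtGroup E Z A) (δ' : ExtGroup E Z' A') : ExtGroup E bZ.pt bA.pt :=
  extPush E bA.inl (extPull E bZ.fst δ) + extPush E bA.inr (extPull E bZ.snd δ')

/-- The underlying direct sum diagram in `C` of one in a full subcategory. -/
abbrev fullSubcategoryBicone {T : ObjectProperty C} {X Y : T.FullSubcategory} (b : BinaryBicone X Y) :
    BinaryBicone X.obj Y.obj :=
  T.ι.mapBinaryBicone b

lemma isDirectSum_bicone {T : ObjectProperty C} {X Y : T.FullSubcategory} {b : BinaryBicone X Y}
    (hb : IsDirectSum b) :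
    IsDirectSum (fullSubcategoryBicone b) :=
  congrArg (fun t : b.pt ⟶ b.pt => t.hom) hb

end Biproduct

/-- An extriangulated structure (Nakaoka–Palu) on an additive category.

The realization `𝔰`, which assigns to every `δ : 𝔼(Z, A)` an equivalence class `𝔰(δ) = [A ⟶ B ⟶ Z]`
of sequences, is encoded by the relation `Realizes x y δ`, meaning `𝔰(δ) = [x, y]`; the first three
axioms on `Realizes` say that for each `δ` the sequences realizing `δ` form exactly one
equivalence class. -/
class Extriangulated (C : Type u) [Category.{v} C] [Preadditive C] [HasZeroObject C]
    [HasFiniteBiproducts C] where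
  /-- the bifunctor `𝔼` -/
  E : Cᵒᵖ ⥤ C ⥤ AddCommGrpCat.{w}
  /-- the realization `𝔰` -/
  Realizes : ∀ {A B Z : C}, (A ⟶ B) → (B ⟶ Z) → ExtGroup E Z A → Prop
  /-- (ET1): `𝔼` is additive in the first variable -/
  additive_left : E.Additive
  /-- (ET1): `𝔼` is additive in the second variable -/
  additive_right : ∀ Z : Cᵒᵖ, (E.obj Z).Additive
  exists_realization : ∀ {A Z : C} (δ : ExtGroup E Z A),
    ∃ (B : C) (x : A ⟶ B) (y : B ⟶ Z), Realizes x y δ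
  seqEquiv_of_realizes : ∀ {A B B' Z : C} {x : A ⟶ B} {y : B ⟶ Z} {x' : A ⟶ B'} {y' : B' ⟶ Z}
    {δ : ExtGroup E Z A}, Realizes x y δ → Realizes x' y' δ → SeqEquiv x y x' y'
  realizes_of_seqEquiv : ∀ {A B B' Z : C} {x : A ⟶ B} {y : B ⟶ Z} {x' : A ⟶ B'} {y' : B' ⟶ Z}
    {δ : ExtGroup E Z A}, Realizes x y δ → SeqEquiv x y x' y' → Realizes x' y' δ
  /-- (ET2): every morphism of extensions `(a, c) : δ ⟶ δ'` lifts to the realizations -/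
  lift_morphism : ∀ {A B Z A' B' Z' : C} {x : A ⟶ B} {y : B ⟶ Z} {x' : A' ⟶ B'} {y' : B' ⟶ Z'}
    {δ : ExtGroup E Z A} {δ' : ExtGroup E Z' A'}, Realizes x y δ → Realizes x' y' δ' →
    ∀ (a : A ⟶ A') (c : Z ⟶ Z'), extPush E a δ = extPull E c δ' →
      ∃ b : B ⟶ B', x ≫ b = a ≫ x' ∧ y ≫ c = b ≫ y'
  /-- (ET2): `𝔰(0) = [A ⟶ A ⊕ Z ⟶ Z]` -/
  realizes_zero : ∀ {A Z : C} (b : BinaryBicone A Z), IsDirectSum b →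
    Realizes b.inl b.snd (0 : ExtGroup E Z A)
  /-- (ET2): `𝔰(δ ⊕ δ') = 𝔰(δ) ⊕ 𝔰(δ')` -/
  realizes_directSum : ∀ {A B Z A' B' Z' : C} {x : A ⟶ B} {y : B ⟶ Z} {x' : A' ⟶ B'}
    {y' : B' ⟶ Z'} {δ : ExtGroup E Z A} {δ' : ExtGroup E Z' A'},
    Realizes x y δ → Realizes x' y' δ' →
    ∀ (bA : BinaryBicone A A') (bB : BinaryBicone B B') (bZ : BinaryBicone Z Z'),
      IsDirectSum bA → IsDirectSum bB → IsDirectSum bZ →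
      Realizes (directSumMap bA bB x x') (directSumMap bB bZ y y') (directSumExt E bA bZ δ δ')
  /-- (ET3) -/
  et3 : ∀ {A B Z A' B' Z' : C} {x : A ⟶ B} {y : B ⟶ Z} {x' : A' ⟶ B'} {y' : B' ⟶ Z'}
    {δ : ExtGroup E Z A} {δ' : ExtGroup E Z' A'}, Realizes x y δ → Realizes x' y' δ' →
    ∀ (a : A ⟶ A') (b : B ⟶ B'), x ≫ b = a ≫ x' →
      ∃ c : Z ⟶ Z', y ≫ c = b ≫ y' ∧ extPush E a δ = extPull E c δ'
  /-- (ET3)ᵒᵖ -/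
  et3_op : ∀ {A B Z A' B' Z' : C} {x : A ⟶ B} {y : B ⟶ Z} {x' : A' ⟶ B'} {y' : B' ⟶ Z'}
    {δ : ExtGroup E Z A} {δ' : ExtGroup E Z' A'}, Realizes x y δ → Realizes x' y' δ' →
    ∀ (b : B ⟶ B') (c : Z ⟶ Z'), y ≫ c = b ≫ y' →
      ∃ a : A ⟶ A', x ≫ b = a ≫ x' ∧ extPush E a δ = extPull E c δ'
  /-- (ET4):
  ```
  A --f--> B --f'--> D
  ‖        |g        |d
  A --h--> Z --h'--> Q
           |g'       |e
           F ======= F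
  ```
  -/
  et4 : ∀ {A B D Z F : C} {f : A ⟶ B} {f' : B ⟶ D} {g : B ⟶ Z} {g' : Z ⟶ F}
    {δ : ExtGroup E D A} {δ' : ExtGroup E F B}, Realizes f f' δ → Realizes g g' δ' →
    ∃ (Q : C) (d : D ⟶ Q) (e : Q ⟶ F) (h' : Z ⟶ Q) (δ'' : ExtGroup E Q A),
      Realizes (f ≫ g) h' δ'' ∧ f' ≫ d = g ≫ h' ∧ h' ≫ e = g' ∧
      Realizes d e (extPush E f' δ') ∧ extPull E d δ'' = δ ∧
      extPush E f δ'' = extPull E e δ'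
  /-- (ET4)ᵒᵖ:
  ```
  D --d--> Q --e--> F
  ‖        |h'      |g'
  D --f'-> A --f--> B
           |h       |g
           Z ====== Z
  ```
  -/
  et4_op : ∀ {D A B F Z : C} {f' : D ⟶ A} {f : A ⟶ B} {g' : F ⟶ B} {g : B ⟶ Z}
    {δ : ExtGroup E B D} {δ' : ExtGroup E Z F}, Realizes f' f δ → Realizes g' g δ' →
    ∃ (Q : C) (d : D ⟶ Q) (e : Q ⟶ F) (h' : Q ⟶ A) (δ'' : ExtGroup E Z Q),
      Realizes h' (f ≫ g) δ'' ∧ d ≫ h' = f' ∧ h' ≫ f = e ≫ g' ∧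
      Realizes d e (extPull E g' δ) ∧ δ' = extPush E e δ'' ∧
      extPush E d δ = extPull E g δ''

section Filtrations

variable {C : Type u} [Category.{v} C] [Preadditive C] [HasZeroObject C]
  [HasFiniteBiproducts C] [Extriangulated.{w} C]

/-- `A ⟶ B ⟶ Z` is a conflation: it is part of an `𝔼`-triangle `A ⟶ B ⟶ Z ⇢`. Then `A ⟶ B` is an
inflation and `Z` is its cone. -/
def IsConflation {A B Z : C} (x : A ⟶ B) (y : B ⟶ Z) : Prop :=
  ∃ δ : ExtGroup (Extriangulated.E.{w} (C := C)) Z A, Extriangulated.Realizes x y δ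

/-- `HasFiltration X M [X₁, …, Xₙ]`: the object `M` has a filtration
`0 = M₀ ⟶ M₁ ⟶ ⋯ ⟶ Mₙ = M` of length `n` by inflations with cones `X₁, …, Xₙ`, all lying in `X`. -/
inductive HasFiltration (X : ObjectProperty C) : C → List C → Prop
  | nil {M : C} (hM : IsZero M) : HasFiltration X M []
  | snoc {M' M S : C} {l : List C} (h : HasFiltration X M' l) (f : M' ⟶ M) (g : M ⟶ S)
      (hfg : IsConflation.{w} f g) (hS : X S) : HasFiltration X M (l ++ [S])

/-- The filtration subcategory `Filt(X)`. -/
def filt (X : ObjectProperty C) : ObjectProperty C :=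
  fun M => ∃ l : List C, HasFiltration.{w} X M l

/-- The `X`-length of `M`: the minimal length of an `X`-filtration (only used for `M` in
`Filt(X)`). -/
noncomputable def filtLength (X : ObjectProperty C) (M : C) : ℕ :=
  sInf {n : ℕ | ∃ l : List C, HasFiltration.{w} X M l ∧ l.length = n}

/-- Two finite sequences of objects are isomorphic: they have the same length and agree up to a
permutation and isomorphisms (a bijection of the index sets forces the lengths to be equal). -/
def SeqIso (l l' : List C) : Prop :=
  ∃ σ : Fin l.length ≃ Fin l'.length, ∀ i, Nonempty (l.get i ≅ l'.get (σ i))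

/-- The conditions of the weak Jordan–Hölder property, for a given class `X` of objects. -/
structure SatisfiesWJHPWith (X : ObjectProperty C) : Prop where
  filt_eq_top : ∀ M : C, filt.{w} X M
  seqIso_of_minimal : ∀ (M : C) (l l' : List C), HasFiltration.{w} X M l →
    HasFiltration.{w} X M l' → l.length = filtLength.{w} X M → l'.length = filtLength.{w} X M →
    SeqIso l l'

/-- The conditions of the Jordan–Hölder property, for a given class `X` of objects. -/
structure SatisfiesJHPWith (X : ObjectProperty C) : Prop extends SatisfiesWJHPWith.{w} X where
  length_eq : ∀ (M : C) (l l' : List C), HasFiltration.{w} X M l → HasFiltration.{w} X M l' →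
    l.length = l'.length

variable (C) in
/-- The extriangulated category `C` satisfies the Jordan–Hölder property (JHP). -/
def SatisfiesJHP : Prop :=
  ∃ X : ObjectProperty C, SatisfiesJHPWith.{w} X

/-- The endomorphism ring of `M` is a division ring. -/
def IsBrick {C : Type u} [Category.{v} C] [Preadditive C] (M : C) : Prop :=
  Nontrivial (End M) ∧ ∀ f : End M, f ≠ 0 → IsUnit f

/-- A semibrick: bricks without nonzero morphisms between non-isomorphic ones. -/
structure IsSemibrick {C : Type u} [Category.{v} C] [Preadditive C] (X : ObjectProperty C) :
    Prop where
  isBrick : ∀ S : C, X S → IsBrick S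
  hom_eq_zero : ∀ S S' : C, X S → X S' → ¬ Nonempty (S ≅ S') → ∀ f : S ⟶ S', f = 0

/-- `N` is a `[1]`-shift of `M`: there is an `𝔼`-triangle `M ⟶ 0 ⟶ N ⇢`. -/
def IsShift (M N : C) : Prop :=
  IsConflation.{w} (0 : M ⟶ (0 : C)) (0 : (0 : C) ⟶ N)

/-- `X` is proper: `S[1] ∉ Filt(X)` for all `S ∈ X`. -/
def IsProper (X : ObjectProperty C) : Prop :=
  ∀ S : C, X S → ¬ ∃ N : C, filt.{w} X N ∧ IsShift.{w} S N

end Filtrations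

section ExtensionClosed

variable {C : Type u} [Category.{v} C] [Preadditive C] [HasZeroObject C]
  [HasFiniteBiproducts C] [Extriangulated.{w} C]

lemma extPull_zero {Z Z' A : C} (δ : ExtGroup (Extriangulated.E.{w} (C := C)) Z A) :
    extPull Extriangulated.E (0 : Z' ⟶ Z) δ = 0 := by
  have := Extriangulated.additive_left.{w} (C := C)
  simp [extPull, Functor.map_zero]

lemma extPull_id {Z A : C} (δ : ExtGroup (Extriangulated.E.{w} (C := C)) Z A) :
    extPull Extriangulated.E (𝟙 Z) δ = δ := by
  simp [extPull]

/-- An extension by a zero object is trivial. -/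
lemma exists_iso_of_isConflation_of_isZero {A B Z : C} {x : A ⟶ B} {y : B ⟶ Z}
    (h : IsConflation.{w} x y) (hZ : IsZero Z) : Nonempty (A ≅ B) := by
  obtain ⟨δ, hδ⟩ := h
  have h0 : δ = 0 := by
    rw [← extPull_id δ, hZ.eq_of_src (𝟙 Z) 0, extPull_zero]
  subst h0
  let b : BinaryBicone A Z :=
    { pt := A, fst := 𝟙 A, snd := 0, inl := 𝟙 A, inr := 0
      inr_snd := hZ.eq_of_src _ _ }
  have hb : IsDirectSum b := by simp [IsDirectSum, b]
  obtain ⟨e, -, -⟩ := Extriangulated.seqEquiv_of_realizes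
    (Extriangulated.realizes_zero b hb) hδ
  exact ⟨e⟩

lemma HasFiltration.of_iso {X : ObjectProperty C} {M N : C} {l : List C}
    (h : HasFiltration.{w} X M l) (e : M ≅ N) : HasFiltration.{w} X N l := by
  cases h with
  | nil hM => exact .nil (hM.of_iso e.symm)
  | snoc h f g hfg hS =>
    obtain ⟨δ, hδ⟩ := hfg
    exact .snoc h (f ≫ e.hom) (e.inv ≫ g)
      ⟨δ, Extriangulated.realizes_of_seqEquiv hδ ⟨e, rfl, by simp⟩⟩ hS

lemma HasFiltration.append {X : ObjectProperty C} {A B Z : C} {l l' : List C}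
    (hA : HasFiltration.{w} X A l) (hZ : HasFiltration.{w} X Z l') (x : A ⟶ B) (y : B ⟶ Z)
    (hxy : IsConflation.{w} x y) : HasFiltration.{w} X B (l ++ l') := by
  induction hZ generalizing B with
  | nil hM =>
    obtain ⟨e⟩ := exists_iso_of_isConflation_of_isZero hxy hM
    simpa using hA.of_iso e
  | snoc h f g hfg hS ih =>
    obtain ⟨δ, hδ⟩ := hxy
    obtain ⟨δ', hδ'⟩ := hfg
    obtain ⟨Q, d, e, h', δ'', h1, -, -, h2, -, -⟩ := Extriangulated.et4_op hδ hδ'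
    rw [← List.append_assoc]
    exact .snoc (ih d e ⟨_, h2⟩) h' (y ≫ g) ⟨_, h1⟩ hS

/-- The full subcategory `T` contains the zero objects and is closed under extensions (hence also
under isomorphisms and finite direct sums). -/
structure IsExtensionClosed (T : ObjectProperty C) : Prop where
  of_isZero : ∀ Z : C, IsZero Z → T Z
  of_isConflation : ∀ {A B Z : C} (x : A ⟶ B) (y : B ⟶ Z), IsConflation.{w} x y →
    T A → T Z → T B

lemma filt_isExtensionClosed (X : ObjectProperty C) :
    IsExtensionClosed.{w} (filt.{w} X) where
  of_isZero _ hZ := ⟨[], .nil hZ⟩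
  of_isConflation x y h := by
    rintro ⟨l, hl⟩ ⟨l', hl'⟩
    exact ⟨l ++ l', hl.append hl' x y h⟩

namespace IsExtensionClosed

variable {T : ObjectProperty C}

lemma hasZeroObject (hT : IsExtensionClosed.{w} T) : HasZeroObject T.FullSubcategory where
  zero := by
    refine ⟨⟨0, hT.of_isZero _ (isZero_zero C)⟩, ?_⟩
    rw [IsZero.iff_id_eq_zero]
    exact ObjectProperty.hom_ext _ ((isZero_zero C).eq_of_src _ _)

lemma hasFiniteBiproducts (hT : IsExtensionClosed.{w} T) :
    HasFiniteBiproducts T.FullSubcategory := by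
  have := hT.hasZeroObject
  have := hasBinaryBiproducts_of_finite_biproducts C
  have : HasBinaryBiproducts T.FullSubcategory := ⟨fun X Y => by
    let b := BinaryBiproduct.bicone X.obj Y.obj
    have hb : IsDirectSum b := biprod.total
    let P : T.FullSubcategory := ⟨b.pt, hT.of_isConflation b.inl b.snd
      ⟨_, Extriangulated.realizes_zero b hb⟩ X.property Y.property⟩
    let b' : BinaryBicone X Y :=
      { pt := P
        fst := ObjectProperty.homMk b.fst
        snd := ObjectProperty.homMk b.snd
        inl := ObjectProperty.homMk b.inl
        inr := ObjectProperty.homMk b.inr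
        inl_fst := ObjectProperty.hom_ext _ b.inl_fst
        inl_snd := ObjectProperty.hom_ext _ b.inl_snd
        inr_fst := ObjectProperty.hom_ext _ b.inr_fst
        inr_snd := ObjectProperty.hom_ext _ b.inr_snd }
    exact hasBinaryBiproduct_of_total b' (ObjectProperty.hom_ext _ hb)⟩
  have : HasFiniteProducts T.FullSubcategory := hasFiniteProducts_of_has_binary_and_terminal
  exact HasFiniteBiproducts.of_hasFiniteProducts

/-- The extriangulated structure of an extension-closed subcategory: `𝔼` and `𝔰` are the
restrictions of those of `C`. -/
@[reducible]
def extriangulated (hT : IsExtensionClosed.{w} T) [HasZeroObject T.FullSubcategory]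
    [HasFiniteBiproducts T.FullSubcategory] : Extriangulated.{w} T.FullSubcategory where
  E := T.ι.op ⋙ Extriangulated.E.{w} ⋙ (Functor.whiskeringLeft _ _ _).obj T.ι
  Realizes x y δ := Extriangulated.Realizes.{w} x.hom y.hom δ
  additive_left := by
    have := Extriangulated.additive_left.{w} (C := C)
    refine ⟨fun {X Y f g} => ?_⟩
    ext A : 2
    exact congrArg (fun t => NatTrans.app t A.obj)
      ((Extriangulated.E.{w} (C := C)).map_add (f := (T.ι.op.map f)) (g := (T.ι.op.map g)))
  additive_right Z := by
    have := Extriangulated.additive_right.{w} (C := C) (op Z.unop.obj)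
    exact ⟨fun {X Y f g} => ((Extriangulated.E.{w} (C := C)).obj (op Z.unop.obj)).map_add
      (f := f.hom) (g := g.hom)⟩
  exists_realization {A Z} δ := by
    obtain ⟨B, x, y, h⟩ := Extriangulated.exists_realization.{w} (A := A.obj) (Z := Z.obj) δ
    exact ⟨⟨B, hT.of_isConflation x y ⟨δ, h⟩ A.property Z.property⟩,
      ObjectProperty.homMk x, ObjectProperty.homMk y, h⟩
  seqEquiv_of_realizes h h' := by
    obtain ⟨e, h1, h2⟩ := Extriangulated.seqEquiv_of_realizes h h'
    exact ⟨T.isoMk e, ObjectProperty.hom_ext _ h1, ObjectProperty.hom_ext _ h2⟩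
  realizes_of_seqEquiv h := by
    rintro ⟨e, h1, h2⟩
    exact Extriangulated.realizes_of_seqEquiv h
      ⟨T.ι.mapIso e, congrArg (·.hom) h1, congrArg (·.hom) h2⟩
  lift_morphism h h' a c hac := by
    obtain ⟨b, h1, h2⟩ := Extriangulated.lift_morphism h h' a.hom c.hom hac
    exact ⟨ObjectProperty.homMk b, ObjectProperty.hom_ext _ h1, ObjectProperty.hom_ext _ h2⟩
  realizes_zero b hb :=
    Extriangulated.realizes_zero (fullSubcategoryBicone b) (isDirectSum_bicone hb)
  realizes_directSum h h' bA bB bZ hA hB hZ :=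
    Extriangulated.realizes_directSum h h' (fullSubcategoryBicone bA) (fullSubcategoryBicone bB) (fullSubcategoryBicone bZ)
      (isDirectSum_bicone hA) (isDirectSum_bicone hB) (isDirectSum_bicone hZ)
  et3 h h' a b hab := by
    obtain ⟨c, h1, h2⟩ := Extriangulated.et3 h h' a.hom b.hom (congrArg (·.hom) hab)
    exact ⟨ObjectProperty.homMk c, ObjectProperty.hom_ext _ h1, h2⟩
  et3_op h h' b c hbc := by
    obtain ⟨a, h1, h2⟩ := Extriangulated.et3_op h h' b.hom c.hom (congrArg (·.hom) hbc)
    exact ⟨ObjectProperty.homMk a, ObjectProperty.hom_ext _ h1, h2⟩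
  et4 {A B D Z F f f' g g' δ δ'} h h' := by
    obtain ⟨Q, d, e, k, δ'', h1, h2, h3, h4, h5, h6⟩ := Extriangulated.et4 h h'
    exact ⟨⟨Q, hT.of_isConflation d e ⟨_, h4⟩ D.property F.property⟩, ObjectProperty.homMk d,
      ObjectProperty.homMk e, ObjectProperty.homMk k, δ'', h1, ObjectProperty.hom_ext _ h2,
      ObjectProperty.hom_ext _ h3, h4, h5, h6⟩
  et4_op {D A B F Z f' f g' g δ δ'} h h' := by
    obtain ⟨Q, d, e, k, δ'', h1, h2, h3, h4, h5, h6⟩ := Extriangulated.et4_op h h'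
    exact ⟨⟨Q, hT.of_isConflation d e ⟨_, h4⟩ D.property F.property⟩, ObjectProperty.homMk d,
      ObjectProperty.homMk e, ObjectProperty.homMk k, δ'', h1, ObjectProperty.hom_ext _ h2,
      ObjectProperty.hom_ext _ h3, h4, h5, h6⟩

end IsExtensionClosed

instance filt_hasZeroObject (X : ObjectProperty C) :
    HasZeroObject (filt.{w} X).FullSubcategory :=
  (filt_isExtensionClosed X).hasZeroObject

instance filt_hasFiniteBiproducts (X : ObjectProperty C) :
    HasFiniteBiproducts (filt.{w} X).FullSubcategory :=
  (filt_isExtensionClosed X).hasFiniteBiproducts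

/-- `Filt(X)` as an extriangulated category. -/
instance filt_extriangulated (X : ObjectProperty C) :
    Extriangulated.{w} (filt.{w} X).FullSubcategory :=
  (filt_isExtensionClosed X).extriangulated

end ExtensionClosed

/-!
Let `X` be a proper semibrick and `M` a nonzero object with two `X`-filtrations. Some `S ∈ X` has a
nonzero morphism to `M`. By Schur's lemma, following this morphism through either filtration shows
that it is an inflation, whose cone is filtered by the factors of that filtration other than one
copy of `S`. The cone does not depend on the filtration, so induction on the length compares the
remaining factors. It remains to see that a zero object has no filtration of positive length, and
this is where properness enters: if `M' ⟶ 0` is the last inflation of one, then composing it with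
an inflation `S ⟶ M'`, `S ∈ X`, gives an inflation `S ⟶ 0` whose cone is in `Filt(X)`.

Conversely, an `𝔼`-triangle `S ⟶ 0 ⟶ N ⇢` in `Filt(X)` splices filtrations of `S` and `N` into a
filtration of `0`. Under (JHP) it has length zero, so that `S = 0`, which is not a brick.
-/

section ExtGroup

variable {C : Type u} [Category.{v} C] (E : Cᵒᵖ ⥤ C ⥤ AddCommGrpCat.{w}) {A A' Z Z' Z'' : C}

lemma extPush_id (δ : ExtGroup E Z A) : extPush E (𝟙 A) δ = δ := by
  simp [extPush]

lemma extPull_comp (c' : Z'' ⟶ Z') (c : Z' ⟶ Z) (δ : ExtGroup E Z A) :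
    extPull E (c' ≫ c) δ = extPull E c' (extPull E c δ) := by
  simp [extPull]

lemma extPush_apply_zero (a : A ⟶ A') : extPush E a (0 : ExtGroup E Z A) = 0 :=
  map_zero _

lemma extPull_apply_zero (c : Z' ⟶ Z) : extPull E c (0 : ExtGroup E Z A) = 0 :=
  map_zero _

variable [Preadditive C]

lemma extPush_zero [(E.obj (op Z)).Additive] (δ : ExtGroup E Z A) :
    extPush E (0 : A ⟶ A') δ = 0 := by
  simp [extPush]

lemma extPull_sub [E.Additive] (c c' : Z' ⟶ Z) (δ : ExtGroup E Z A) :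
    extPull E (c - c') δ = extPull E c δ - extPull E c' δ := by
  simp [extPull, Functor.map_sub]

end ExtGroup

section Conflation

open Extriangulated

attribute [local instance] Extriangulated.additive_left Extriangulated.additive_right

variable {C : Type u} [Category.{v} C] [Preadditive C] [HasZeroObject C]
  [HasFiniteBiproducts C] [Extriangulated.{w} C]

lemma realizes_id_zero (A : C) {Z : C} (hZ : IsZero Z) :
    Realizes.{w} (𝟙 A) (0 : A ⟶ Z) 0 := by
  let b : BinaryBicone A Z :=
    { pt := A, fst := 𝟙 A, snd := 0, inl := 𝟙 A, inr := 0
      inr_snd := hZ.eq_of_src _ _ }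
  exact realizes_zero b (by simp [IsDirectSum, b])

lemma realizes_zero_id (Z : C) {A : C} (hA : IsZero A) :
    Realizes.{w} (0 : A ⟶ Z) (𝟙 Z) 0 := by
  let b : BinaryBicone A Z :=
    { pt := Z, fst := 0, snd := 𝟙 Z, inl := 0, inr := 𝟙 Z
      inl_fst := hA.eq_of_src _ _ }
  exact realizes_zero b (by simp [IsDirectSum, b])

variable {A B Z W : C} {x : A ⟶ B} {y : B ⟶ Z} {δ : ExtGroup (E.{w} (C := C)) Z A}

lemma extPull_eq_zero_of_realizes (h : Realizes x y δ) : extPull E y δ = 0 := by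
  obtain ⟨c, hc, hδ⟩ := et3 (realizes_zero_id B (isZero_zero C)) h 0 (𝟙 B) (by simp)
  obtain rfl : c = y := by simpa using hc
  rw [← hδ, extPush_apply_zero]

lemma exists_lift_of_extPull_eq_zero (h : Realizes x y δ) (f : W ⟶ Z)
    (hf : extPull E f δ = 0) : ∃ g : W ⟶ B, g ≫ y = f := by
  obtain ⟨g, -, hg⟩ := lift_morphism (realizes_zero_id W (isZero_zero C)) h 0 f
    (by rw [hf, extPush_apply_zero])
  exact ⟨g, by simpa using hg.symm⟩

lemma eq_zero_of_realizes_of_isIso_comp (h : Realizes x y δ) (f : W ⟶ B) [IsIso (f ≫ y)] :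
    δ = 0 :=
  calc
    δ = extPull E (inv (f ≫ y) ≫ f ≫ y) δ := by rw [IsIso.inv_hom_id, extPull_id]
    _ = extPull E (inv (f ≫ y)) (extPull E f (extPull E y δ)) := by simp only [extPull_comp]
    _ = 0 := by simp only [extPull_eq_zero_of_realizes h, extPull_apply_zero]

namespace IsConflation

lemma exists_lift (h : IsConflation.{w} x y) (f : W ⟶ B) (hf : f ≫ y = 0) :
    ∃ g : W ⟶ A, g ≫ x = f := by
  obtain ⟨δ, h⟩ := h
  obtain ⟨g, hg, -⟩ := et3_op (realizes_id_zero W (isZero_zero C)) h f 0 (by simp [hf])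
  exact ⟨g, by simpa using hg.symm⟩

lemma exists_desc (h : IsConflation.{w} x y) (f : B ⟶ W) (hf : x ≫ f = 0) :
    ∃ g : Z ⟶ W, y ≫ g = f := by
  obtain ⟨δ, h⟩ := h
  obtain ⟨g, hg, -⟩ := et3 h (realizes_zero_id W (isZero_zero C)) 0 f (by simp [hf])
  exact ⟨g, by simpa using hg⟩

lemma comp_iso {B' : C} (h : IsConflation.{w} x y) (e : B ≅ B') :
    IsConflation.{w} (x ≫ e.hom) (e.inv ≫ y) := by
  obtain ⟨δ, h⟩ := h
  exact ⟨δ, realizes_of_seqEquiv h ⟨e, rfl, by simp⟩⟩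

lemma isShift (h : IsConflation.{w} x y) (hB : IsZero B) : IsShift.{w} A Z := by
  have h0 := h.comp_iso (hB.iso (isZero_zero C))
  rwa [(isZero_zero C).eq_of_tgt (x ≫ _) 0, (isZero_zero C).eq_of_src (_ ≫ y) 0] at h0

lemma nonempty_iso_of_isZero_left (h : IsConflation.{w} x y) (hA : IsZero A) :
    Nonempty (B ≅ Z) := by
  obtain ⟨δ, h⟩ := h
  obtain rfl : δ = 0 := by rw [← extPush_id E δ, hA.eq_of_src (𝟙 A) 0, extPush_zero]
  obtain ⟨e, -, -⟩ := seqEquiv_of_realizes h (realizes_zero_id Z hA)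
  exact ⟨e⟩

end IsConflation

lemma isIso_of_realizes (h : Realizes x y δ) (c : Z ⟶ Z) (hy : y ≫ c = y)
    (hc : extPull E c δ = δ) : IsIso c := by
  obtain ⟨v, hv⟩ := exists_lift_of_extPull_eq_zero h (c - 𝟙 Z)
    (by rw [extPull_sub, hc, extPull_id, sub_self])
  have hsq : (c - 𝟙 Z) ≫ (c - 𝟙 Z) = 0 := by
    nth_rw 1 [← hv]
    simp [hy]
  let u : End Z := c - 𝟙 Z
  have hu : IsNilpotent u := ⟨2, (pow_two u).trans hsq⟩
  have huc : u + 1 = c := sub_add_cancel c (𝟙 Z)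
  exact (isUnit_iff_isIso c).1 (huc ▸ hu.isUnit_add_one)

lemma IsConflation.nonempty_iso_cone {Z' : C} {y' : B ⟶ Z'} (h : IsConflation.{w} x y)
    (h' : IsConflation.{w} x y') : Nonempty (Z ≅ Z') := by
  obtain ⟨δ, h⟩ := h
  obtain ⟨δ', h'⟩ := h'
  obtain ⟨c, hc, hδ⟩ := et3 h h' (𝟙 A) (𝟙 B) (by simp)
  obtain ⟨c', hc', hδ'⟩ := et3 h' h (𝟙 A) (𝟙 B) (by simp)
  rw [extPush_id] at hδ hδ'
  rw [Category.id_comp] at hc hc'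
  have : IsIso (c ≫ c') := isIso_of_realizes h _ (by rw [← Category.assoc, hc, hc'])
    (by rw [extPull_comp, ← hδ', ← hδ])
  have : IsIso (c' ≫ c) := isIso_of_realizes h' _ (by rw [← Category.assoc, hc', hc])
    (by rw [extPull_comp, ← hδ, ← hδ'])
  have : Mono c := mono_of_mono c c'
  have : IsSplitEpi c := ⟨⟨inv (c' ≫ c) ≫ c', by simp⟩⟩
  have : IsIso c := isIso_of_mono_of_isSplitEpi c
  exact ⟨asIso c⟩

lemma isConflation_of_isIso_comp_snd [HasBinaryBiproducts C] {S : C} (f : S ⟶ A ⊞ Z)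
    [IsIso (f ≫ biprod.snd)] :
    IsConflation.{w} f
      (biprod.fst - biprod.snd ≫ inv (f ≫ biprod.snd) ≫ f ≫ biprod.fst : A ⊞ Z ⟶ A) := by
  let b : BinaryBicone S A :=
    { pt := A ⊞ Z
      fst := biprod.snd ≫ inv (f ≫ biprod.snd)
      snd := biprod.fst - biprod.snd ≫ inv (f ≫ biprod.snd) ≫ f ≫ biprod.fst
      inl := f
      inr := biprod.inl
      inl_fst := by rw [← Category.assoc, IsIso.hom_inv_id]
      inl_snd := by
        rw [Preadditive.comp_sub, ← Category.assoc f biprod.snd, IsIso.hom_inv_id_assoc, sub_self] }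
  have hb : IsDirectSum b := by
    simp only [IsDirectSum, b]
    ext <;> simp
  exact ⟨0, realizes_zero b hb⟩

/-- The conflation splits, and up to an automorphism of `B ≅ A ⊞ Z` the morphism `f` is the
inclusion of the second summand. -/
lemma IsConflation.exists_retraction_conflation {S : C} (h : IsConflation.{w} x y) (f : S ⟶ B)
    [IsIso (f ≫ y)] : ∃ r : B ⟶ A, IsConflation.{w} f r := by
  have := hasBinaryBiproducts_of_finite_biproducts C
  obtain ⟨δ, h⟩ := h
  obtain rfl : δ = 0 := eq_zero_of_realizes_of_isIso_comp h f
  obtain ⟨e, -, he⟩ := seqEquiv_of_realizes h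
    (realizes_zero (BinaryBiproduct.bicone A Z) biprod.total)
  have : IsIso ((f ≫ e.hom) ≫ biprod.snd) := by
    rw [Category.assoc]
    exact he.symm ▸ inferInstance
  exact ⟨_, by simpa using (isConflation_of_isIso_comp_snd (f ≫ e.hom)).comp_iso e.symm⟩

end Conflation

section SeqIso

variable {C : Type u} [Category.{v} C]

namespace SeqIso

variable {S S' : C} {l l' l'' : List C}

lemma refl (l : List C) : SeqIso l l :=
  ⟨Equiv.refl _, fun _ => ⟨Iso.refl _⟩⟩

lemma symm (h : SeqIso l l') : SeqIso l' l := by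
  obtain ⟨σ, hσ⟩ := h
  exact ⟨σ.symm, fun i => by simpa using (hσ (σ.symm i)).map Iso.symm⟩

lemma trans (h : SeqIso l l') (h' : SeqIso l' l'') : SeqIso l l'' := by
  obtain ⟨σ, hσ⟩ := h
  obtain ⟨τ, hτ⟩ := h'
  exact ⟨σ.trans τ, fun i => (hσ i).map2 Iso.trans (hτ (σ i))⟩

lemma length_eq (h : SeqIso l l') : l.length = l'.length := by
  obtain ⟨σ, -⟩ := h
  simpa using Fintype.card_congr σ

lemma cons (e : S ≅ S') (h : SeqIso l l') : SeqIso (S :: l) (S' :: l') := by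
  obtain ⟨σ, hσ⟩ := h
  refine ⟨(finSuccEquiv _).trans (σ.optionCongr.trans (finSuccEquiv _).symm), ?_⟩
  exact Fin.cases ⟨by simpa using e⟩ fun i => by simpa using hσ i

lemma of_perm (h : l.Perm l') : SeqIso l l' := by
  induction h with
  | nil => exact refl _
  | cons S _ ih => exact ih.cons (Iso.refl S)
  | swap S T l =>
    refine ⟨Equiv.swap (0 : Fin (l.length + 2)) 1, Fin.cases ?_ (Fin.cases ?_ fun i => ?_)⟩
    · simpa using ⟨Iso.refl T⟩
    · simpa using ⟨Iso.refl S⟩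
    · rw [Equiv.swap_apply_of_ne_of_ne (by simp) (by simp [Fin.ext_iff])]
      exact ⟨Iso.refl _⟩
  | trans _ _ ih ih' => exact ih.trans ih'

lemma concat (h : SeqIso l l') (S : C) : SeqIso (l ++ [S]) (l' ++ [S]) :=
  (of_perm (List.perm_append_singleton S l)).trans <|
    (h.cons (Iso.refl S)).trans (of_perm (List.perm_append_singleton S l').symm)

lemma of_map {D : Type*} [Category* D] (F : C ⥤ D) [F.Full] [F.Faithful]
    (h : SeqIso (l.map F.obj) (l'.map F.obj)) : SeqIso l l' := by
  obtain ⟨σ, hσ⟩ := h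
  refine ⟨(finCongr (by simp)).trans (σ.trans (finCongr (by simp))), fun i => ?_⟩
  obtain ⟨e⟩ := hσ (finCongr (by simp) i)
  exact ⟨F.preimageIso (eqToIso (by simp) ≪≫ e ≪≫ eqToIso (by simp))⟩

end SeqIso

end SeqIso

section Semibrick

variable {C : Type u} [Category.{v} C] [Preadditive C]

lemma IsBrick.not_isZero {S : C} (h : IsBrick S) : ¬ IsZero S := fun hS =>
  have := h.1
  one_ne_zero (α := End S) (hS.eq_of_src _ _)

lemma IsSemibrick.isIso_of_ne_zero {X : ObjectProperty C} (hX : IsSemibrick X) {S S' : C}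
    (hS : X S) (hS' : X S') (f : S ⟶ S') (hf : f ≠ 0) : IsIso f := by
  obtain ⟨e⟩ : Nonempty (S ≅ S') := by
    by_contra h
    exact hf (hX.hom_eq_zero S S' hS hS' h f)
  have hfe : f ≫ e.inv ≠ 0 := by simpa using hf
  have : IsIso (f ≫ e.inv) := (isUnit_iff_isIso _).1 ((hX.isBrick S hS).2 (f ≫ e.inv) hfe)
  exact IsIso.of_isIso_comp_right f e.inv

end Semibrick

section JordanHolder

variable {C : Type u} [Category.{v} C] [Preadditive C] [HasZeroObject C]
  [HasFiniteBiproducts C] [Extriangulated.{w} C] {X : ObjectProperty C}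

namespace HasFiltration

lemma isZero {M : C} (h : HasFiltration.{w} X M []) : IsZero M := by
  generalize hl : ([] : List C) = l at h
  cases h with
  | nil hM => exact hM
  | snoc => simp at hl

lemma singleton {S : C} (hS : X S) : HasFiltration.{w} X S [S] :=
  .snoc (.nil (isZero_zero C)) 0 (𝟙 S) ⟨0, realizes_zero_id S (isZero_zero C)⟩ hS

lemma exists_hom_ne_zero {M W : C} {l : List C} (h : HasFiltration.{w} X M l) (f : M ⟶ W)
    (hf : f ≠ 0) : ∃ (S : C) (g : S ⟶ W), X S ∧ g ≠ 0 := by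
  induction h with
  | nil hM => exact absurd (hM.eq_of_src _ _) hf
  | snoc _ x y hxy hS ih =>
    by_cases hx : x ≫ f = 0
    · obtain ⟨g, rfl⟩ := hxy.exists_desc f hx
      exact ⟨_, g, hS, fun hg => hf (by rw [hg, comp_zero])⟩
    · exact ih _ hx

lemma exists_hom_ne_zero_of_not_isZero {M : C} {l : List C} (h : HasFiltration.{w} X M l)
    (hM : ¬ IsZero M) : ∃ (S : C) (f : S ⟶ M), X S ∧ f ≠ 0 :=
  h.exists_hom_ne_zero (𝟙 M) (mt (IsZero.iff_id_eq_zero M).2 hM)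

lemma exists_cone_comp {S M M' N S' : C} {m : List C} {f : S ⟶ M'} {g : M' ⟶ N} {x : M' ⟶ M}
    {y : M ⟶ S'} (hN : HasFiltration.{w} X N m) (hfg : IsConflation.{w} f g)
    (hxy : IsConflation.{w} x y) (hS' : X S') :
    ∃ (Q : C) (q : M ⟶ Q), IsConflation.{w} (f ≫ x) q ∧ HasFiltration.{w} X Q (m ++ [S']) := by
  obtain ⟨δ, hδ⟩ := hfg
  obtain ⟨δ', hδ'⟩ := hxy
  obtain ⟨Q, d, e, q, δ'', hq, -, -, hde, -, -⟩ := Extriangulated.et4 hδ hδ'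
  exact ⟨Q, q, ⟨_, hq⟩, hN.snoc d e ⟨_, hde⟩ hS'⟩

lemma exists_cone_of_ne_zero (hX : IsSemibrick X) {M S : C} {l : List C}
    (h : HasFiltration.{w} X M l) (hS : X S) (f : S ⟶ M) (hf : f ≠ 0) :
    ∃ (N : C) (g : M ⟶ N) (m : List C), IsConflation.{w} f g ∧ HasFiltration.{w} X N m ∧
      SeqIso l (S :: m) := by
  induction h with
  | nil hM => exact absurd (hM.eq_of_tgt _ _) hf
  | @snoc M' M S' l h x y hxy hS' ih =>
    by_cases hy : f ≫ y = 0
    · obtain ⟨f, rfl⟩ := hxy.exists_lift f hy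
      obtain ⟨N, g, m, hfg, hN, hl⟩ := ih f fun h0 => hf (by rw [h0, zero_comp])
      obtain ⟨Q, q, hq, hQ⟩ := hN.exists_cone_comp hfg hxy hS'
      exact ⟨Q, q, m ++ [S'], hq, hQ, hl.concat S'⟩
    · have := hX.isIso_of_ne_zero hS hS' (f ≫ y) hy
      obtain ⟨r, hr⟩ := hxy.exists_retraction_conflation f
      exact ⟨M', r, l, hr, h, (SeqIso.of_perm (List.perm_append_singleton S' l)).trans
        ((SeqIso.refl l).cons (asIso (f ≫ y)).symm)⟩

lemma eq_nil_of_isZero (hX : IsSemibrick X) (hp : IsProper.{w} X) {M : C} {l : List C}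
    (h : HasFiltration.{w} X M l) (hM : IsZero M) : l = [] := by
  cases h with
  | nil => rfl
  | @snoc M' _ S' _ h x y hxy hS' =>
    exfalso
    by_cases hM' : IsZero M'
    · obtain ⟨e⟩ := hxy.nonempty_iso_of_isZero_left hM'
      exact (hX.isBrick S' hS').not_isZero (hM.of_iso e.symm)
    · obtain ⟨S, f, hS, hf⟩ := h.exists_hom_ne_zero_of_not_isZero hM'
      obtain ⟨N, g, m, hfg, hN, -⟩ := h.exists_cone_of_ne_zero hX hS f hf
      obtain ⟨Q, q, hq, hQ⟩ := hN.exists_cone_comp hfg hxy hS'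
      exact hp S hS ⟨Q, ⟨_, hQ⟩, hq.isShift hM⟩

theorem seqIso (hX : IsSemibrick X) (hp : IsProper.{w} X) {M : C} {l l' : List C}
    (h : HasFiltration.{w} X M l) (h' : HasFiltration.{w} X M l') : SeqIso l l' := by
  induction hn : l.length using Nat.strong_induction_on generalizing M l l' with
  | _ n ih =>
    by_cases hM : IsZero M
    · rw [h.eq_nil_of_isZero hX hp hM, h'.eq_nil_of_isZero hX hp hM]
      exact .refl []
    · obtain ⟨S, f, hS, hf⟩ := h.exists_hom_ne_zero_of_not_isZero hM
      obtain ⟨N, g, m, hfg, hN, hl⟩ := h.exists_cone_of_ne_zero hX hS f hf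
      obtain ⟨N', g', m', hfg', hN', hl'⟩ := h'.exists_cone_of_ne_zero hX hS f hf
      obtain ⟨e⟩ := hfg'.nonempty_iso_cone hfg
      have hlt : m.length < n := by simp [← hn, hl.length_eq]
      have hm : SeqIso m m' := ih m.length hlt hN (hN'.of_iso e) rfl
      exact hl.trans ((hm.cons (Iso.refl S)).trans hl'.symm)

lemma filt_fullSubcategory {M : C} {l : List C} (h : HasFiltration.{w} X M l)
    (hM : filt.{w} X M) :
    filt.{w} (X.inverseImage (filt.{w} X).ι) (⟨M, hM⟩ : (filt.{w} X).FullSubcategory) := by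
  induction h with
  | nil h0 => exact ⟨[], .nil (.of_full_of_faithful_of_isZero (filt.{w} X).ι _ h0)⟩
  | @snoc M' M S l h x y hxy hS ih =>
    obtain ⟨m, hm⟩ := ih ⟨l, h⟩
    let S₁ : (filt.{w} X).FullSubcategory := ⟨S, [S], singleton hS⟩
    exact ⟨m ++ [S₁], hm.snoc (S := S₁) (ObjectProperty.homMk x) (ObjectProperty.homMk y) hxy hS⟩

lemma of_fullSubcategory {M : (filt.{w} X).FullSubcategory}
    {l : List (filt.{w} X).FullSubcategory}
    (h : HasFiltration.{w} (X.inverseImage (filt.{w} X).ι) M l) :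
    HasFiltration.{w} X M.obj (l.map (filt.{w} X).ι.obj) := by
  induction h with
  | nil hM => exact .nil ((filt.{w} X).ι.map_isZero hM)
  | snoc _ x y hxy hS ih =>
    rw [List.map_append]
    exact ih.snoc x.hom y.hom hxy hS

end HasFiltration

theorem IsProper.satisfiesJHPWith (hX : IsSemibrick X) (hp : IsProper.{w} X) :
    SatisfiesJHPWith.{w} (X.inverseImage (filt.{w} X).ι) := by
  have hseq : ∀ {M : (filt.{w} X).FullSubcategory} {l l' : List (filt.{w} X).FullSubcategory},
      HasFiltration.{w} (X.inverseImage (filt.{w} X).ι) M l →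
      HasFiltration.{w} (X.inverseImage (filt.{w} X).ι) M l' → SeqIso l l' := fun h h' =>
    .of_map (filt.{w} X).ι (h.of_fullSubcategory.seqIso hX hp h'.of_fullSubcategory)
  exact
    { filt_eq_top := fun ⟨_, _, h⟩ => h.filt_fullSubcategory _
      seqIso_of_minimal := fun _ _ _ h h' _ _ => hseq h h'
      length_eq := fun _ _ _ h h' => (hseq h h').length_eq }

lemma SatisfiesJHP.isZero_of_isConflation (h : SatisfiesJHP.{w} C) {A B Z : C} {x : A ⟶ B}
    {y : B ⟶ Z} (hxy : IsConflation.{w} x y) (hB : IsZero B) : IsZero A := by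
  obtain ⟨Y, hY⟩ := h
  obtain ⟨l, hl⟩ := hY.filt_eq_top A
  obtain ⟨m, hm⟩ := hY.filt_eq_top Z
  have hnil : l ++ m = [] :=
    List.eq_nil_of_length_eq_zero (hY.length_eq B _ _ (hl.append hm x y hxy) (.nil hB))
  obtain ⟨rfl, -⟩ := List.append_eq_nil_iff.1 hnil
  exact hl.isZero

theorem SatisfiesJHP.isProper (hX : ∀ S, X S → ¬ IsZero S)
    (h : SatisfiesJHP.{w} (filt.{w} X).FullSubcategory) : IsProper.{w} X := by
  rintro S hS ⟨N, hN, hSN⟩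
  let S' : (filt.{w} X).FullSubcategory := ⟨S, [S], .singleton hS⟩
  let O : (filt.{w} X).FullSubcategory := ⟨0, [], .nil (isZero_zero C)⟩
  let N' : (filt.{w} X).FullSubcategory := ⟨N, hN⟩
  have hO : IsZero O := .of_full_of_faithful_of_isZero (filt.{w} X).ι O (isZero_zero C)
  have hSON : IsConflation.{w} (0 : S' ⟶ O) (0 : O ⟶ N') := hSN
  exact hX S hS ((filt.{w} X).ι.map_isZero (h.isZero_of_isConflation hSON hO))

end JordanHolder

theorem theorem3p9 {C : Type u} [Category.{v} C] [Preadditive C] [HasZeroObject C]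
    [HasFiniteBiproducts C] [Extriangulated.{w} C] (X : ObjectProperty C) (hX : IsSemibrick X) :
    (SatisfiesJHP.{w} (filt.{w} X).FullSubcategory ↔ IsProper.{w} X) ∧
      (SatisfiesJHPWith.{w} (X.inverseImage (filt.{w} X).ι) ↔ IsProper.{w} X) := by
  have hproper (h : SatisfiesJHP.{w} (filt.{w} X).FullSubcategory) : IsProper.{w} X :=
    h.isProper fun S hS => (hX.isBrick S hS).not_isZero
  exact ⟨⟨hproper, fun hp => ⟨_, hp.satisfiesJHPWith hX⟩⟩,
    ⟨fun h => hproper ⟨_, h⟩, fun hp => hp.satisfiesJHPWith hX⟩⟩
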